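/- Let $k\ge 1$ and $E_k=\{0,1,\dots,k-1\}$. A function $f:E_k^m\to E_k$ preserves a relation $\rho\subseteq E_k^h$ ($h\ge 0$) if applying $f$ coordinatewise to any $m$ tuples of $\rho$ again gives a tuple of $\rho$; a set $G$ of relations on $E_k$ admits $f$ if $f$ preserves every relation in $G$. An $m$-ary function $f$ on $E_k$ is a near-unanimity function if $$f(a,b,b,\dots,b)=f(b,a,b,\dots,b)=\dots=f(b,b,\dots,b,a)=b\qquad\text{for all } a,b\in E_k.$$ Let $G$ be a finite set of relations on $E_k$, and let $ar(G)$ be the maximal arity of the relations in $G$; suppose $ar(G)\ge 1$, i.e. $G$ contains at least one relation of positive arity. Then $G$ admits a near-unanimity function of some arity $m\ge 3$ if and only if $G$ admits a near-unanimity function of arity exactly $$n=(k\cdot ar(G))^{2^{2k^2}+2}.$$ -/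

import Mathlib

namespace NearUnanimity

/-- `n`-ary functions on `E_k = {0, …, k-1}`. -/
abbrev Op (k n : ℕ) : Type := (Fin n → Fin k) → Fin k

/-- Predicates (relations) on `E_k` of arbitrary finite arity `≥ 0`: an arity together with
the set of tuples on which the predicate holds. -/
abbrev Pred (k : ℕ) : Type := Σ h : ℕ, Set (Fin h → Fin k)

/-- `f` preserves `ρ`: applying `f` coordinatewise to tuples of `ρ` gives a tuple of `ρ`. -/
def Preserves {k m : ℕ} (f : Op k m) (ρ : Pred k) : Prop :=
  ∀ α : Fin m → Fin ρ.1 → Fin k, (∀ i, α i ∈ ρ.2) → (fun j => f (fun i => α i j)) ∈ ρ.2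

/-- The `m`-ary functions that preserve every predicate of `G`. -/
def Pol {k : ℕ} (G : Set (Pred k)) (m : ℕ) : Set (Op k m) :=
  {f | ∀ ρ ∈ G, Preserves f ρ}

/-- The near-unanimity functions of arity `n`: the value is `b` whenever all arguments
except possibly one equal `b`. -/
def NUF (k n : ℕ) : Set (Op k n) :=
  {f | ∀ (a b : Fin k) (i : Fin n), f (Function.update (fun _ => b) i a) = b}

/-- The maximal arity of the predicates in a finite set (`0` for the empty set). -/
def ar {k : ℕ} (G : Finset (Pred k)) : ℕ := G.sup fun ρ => ρ.1

end NearUnanimity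

/-! Only the passage from some arity `m` to arity `n` is substantial. An `n`-ary near-unanimity
function preserving `G` is a solution of a constraint problem with variable set E_k^n: the
constraints come from `G`, and a tuple equal to b up to one coordinate must get the value b. For
each pair of variables, take the least binary relation derivable by tree formulas
(`exists_least_typed`). Two facts then suffice, given an `m`-ary near-unanimity function f
preserving `G`.

These relations are nonempty (`Term.Typed.val_nonempty`). Take an unsatisfiable tree formula that
becomes satisfiable when any leaf is dropped. The state at a node is the disjoint pair of the values
its subtree allows and the values the rest of the tree accepts. By absorption through f, no state
recurs below a branching, so there are at most β^(3^(k²)) leaves, where β bounds the premises of a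
rule. A leaf spoils only one of the `n` coordinates; for larger `n` some coordinate is untouched and
satisfies the formula, a contradiction.

A nonempty path-consistent system is solvable (`exists_solution_of_pathConsistent`). Path
consistency makes walks in the incidence graph reversible. Singletons are absorbing because f is
near-unanimity, and propagating a suitable absorbing set shrinks the domains, keeping arc
consistency and reversibility, until all are singletons. -/

namespace NearUnanimity

open Relation

/-! ### Near-unanimity operations and absorption along walks -/

/-- `g` takes the value `x` as soon as all arguments except possibly one equal `x`. -/
def IsNU {X : Type} {m : ℕ} (g : (Fin m → X) → X) : Prop :=
  ∀ (x y : X) (i : Fin m), g (Function.update (fun _ => x) i y) = x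

theorem IsNU.eq_of_forall_ne {X : Type} {m : ℕ} {g : (Fin m → X) → X} (hg : IsNU g)
    {x : X} {z : Fin m → X} (i : Fin m) (h : ∀ j, j ≠ i → z j = x) : g z = x := by
  have : z = Function.update (fun _ => x) i (z i) := by
    funext j
    by_cases hj : j = i
    · subst hj; simp
    · simp [hj, h j hj]
  rw [this]
  exact hg _ _ _

theorem IsNU.const {X : Type} {m : ℕ} {g : (Fin m → X) → X} (hg : IsNU g) (i : Fin m) (x : X) :
    g (fun _ => x) = x :=
  hg.eq_of_forall_ne i fun _ _ => rfl

/-- The relation `δ` absorbs `δ'` through the operations `g` and `h`. -/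
def AbsorbsRel {X Y : Type} {m : ℕ} (g : (Fin m → X) → X) (h : (Fin m → Y) → Y)
    (δ δ' : X → Y → Prop) : Prop :=
  ∀ (j : Fin m) (u : Fin m → X) (v : Fin m → Y), (∀ i, i ≠ j → δ (u i) (v i)) →
    δ' (u j) (v j) → δ (g u) (h v)

/-- A walk whose single `δ'`-step is preceded and followed by arbitrarily long `δ`-walks can be
turned into a `δ`-walk when `δ` absorbs `δ'`. -/
theorem AbsorbsRel.walk {X : Type} {m : ℕ} {g : (Fin m → X) → X} {δ δ' : X → X → Prop}
    (h : AbsorbsRel g g δ δ') (p q : ℕ → X) (hp : ∀ i, δ (p (i + 1)) (p i))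
    (hpq : δ' (p 0) (q 0)) (hq : ∀ i, δ (q i) (q (i + 1))) :
    ReflTransGen δ (g fun i => p i) (g fun i => q (m - 1 - i)) := by
  -- At time `t` the coordinates below `t` have passed to `q`. In the next step coordinate `t` makes
  -- the single `δ'`-step from `p 0` to `q 0`, while all others make a `δ`-step.
  let w : ℕ → Fin m → X := fun t i => if t ≤ (i : ℕ) then p (i - t) else q (t - i - 1)
  have step : ∀ t, t < m → δ (g (w t)) (g (w (t + 1))) := by
    intro t ht
    refine h ⟨t, ht⟩ _ _ ?_ ?_
    · intro i hi
      have hne : (i : ℕ) ≠ t := fun e => hi (Fin.ext e)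
      rcases lt_or_gt_of_ne hne with hlt | hgt
      · have e : t + 1 - (i : ℕ) - 1 = (t - i - 1) + 1 := by omega
        simp only [w, if_neg (show ¬ t ≤ (i : ℕ) by omega),
          if_neg (show ¬ t + 1 ≤ (i : ℕ) by omega), e]
        exact hq _
      · have e : (i : ℕ) - t = (i - (t + 1)) + 1 := by omega
        simp only [w, if_pos (show t ≤ (i : ℕ) by omega),
          if_pos (show t + 1 ≤ (i : ℕ) by omega), e]
        exact hp _
    · simpa [w] using hpq
  have walk : ∀ t, t ≤ m → ReflTransGen δ (g (w 0)) (g (w t)) := by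
    intro t
    induction t with
    | zero => intro _; exact .refl
    | succ t ih => intro ht; exact (ih (by omega)).tail (step t (by omega))
  have h0 : w 0 = fun i : Fin m => p i := by funext i; simp [w]
  have hm : w m = fun i : Fin m => q (m - 1 - i) := by
    funext i
    have e : m - (i : ℕ) - 1 = m - 1 - i := by omega
    simp only [w, if_neg (show ¬ m ≤ (i : ℕ) by omega), e]
  have := walk m le_rfl
  rwa [h0, hm] at this

/-! ### Tree formulas and their relaxations -/

/-- Tree-shaped primitive positive formulas: the inner nodes are labelled by relations
(indexed by `Ω`), the leaves fix a value, and `top` is the trivial formula. -/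
inductive Term (X Ω : Type) (ι : Ω → Type) : Type
  | top : Term X Ω ι
  | leaf (x : X) : Term X Ω ι
  | node (o : Ω) (c : ι o → Term X Ω ι) : Term X Ω ι

namespace Term

variable {X Ω : Type} {ι : Ω → Type}

/-- The set defined by a tree formula at its root. -/
def val (ρ : ∀ o, (ι o → X) → X → Prop) : Term X Ω ι → Set X
  | top => Set.univ
  | leaf x => {x}
  | node o c => {y | ∃ t, ρ o t y ∧ ∀ j, t j ∈ val ρ (c j)}

/-- The number of leaves that fix a value. -/
def leaves [∀ o, Fintype (ι o)] : Term X Ω ι → ℕ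
  | top => 0
  | leaf _ => 1
  | node _ c => ∑ j, leaves (c j)

/-- `Relax S S'`: the formula `S'` arises from `S` by dropping one leaf. -/
inductive Relax [∀ o, DecidableEq (ι o)] : Term X Ω ι → Term X Ω ι → Prop
  | leaf (x : X) : Relax (.leaf x) .top
  | node (o : Ω) (c : ι o → Term X Ω ι) (j : ι o) (T : Term X Ω ι) :
      Relax (c j) T → Relax (.node o c) (.node o (Function.update c j T))

/-- A tree formula in the indicator instance: every vertex carries an element of `X ^ n`, the
relations hold in each of the `n` coordinates, and a leaf `x` sits at a tuple that equals `x`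
up to one coordinate. -/
def Typed (ρ : ∀ o, (ι o → X) → X → Prop) {n : ℕ} : (Fin n → X) → Term X Ω ι → Prop
  | _, top => True
  | σ, leaf x => ∃ i, ∀ j, j ≠ i → σ j = x
  | σ, node o c => ∃ τ : ι o → Fin n → X,
      (∀ i, ρ o (fun j => τ j i) (σ i)) ∧ ∀ j, Typed ρ (τ j) (c j)

theorem exists_relax [∀ o, Fintype (ι o)] [∀ o, DecidableEq (ι o)] :
    ∀ S : Term X Ω ι, S.leaves ≠ 0 → ∃ S', Relax S S'
  | top, h => (h rfl).elim
  | leaf x, _ => ⟨_, .leaf x⟩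
  | node o c, h => by
      obtain ⟨j, -, hj⟩ := Finset.exists_ne_zero_of_sum_ne_zero (show ∑ j, (c j).leaves ≠ 0 from h)
      obtain ⟨S', hS⟩ := exists_relax (c j) hj
      exact ⟨_, .node o c j S' hS⟩

theorem Relax.leaves_lt [∀ o, Fintype (ι o)] [∀ o, DecidableEq (ι o)] {S S' : Term X Ω ι}
    (h : Relax S S') : S'.leaves < S.leaves := by
  induction h with
  | leaf x => simp [leaves]
  | node o c j T _ ih =>
    refine Finset.sum_lt_sum (fun i _ => ?_) ⟨j, Finset.mem_univ _, by simpa using ih⟩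
    by_cases hi : i = j
    · subst hi; simpa using ih.le
    · simp [hi]

theorem Relax.typed [∀ o, DecidableEq (ι o)] {ρ : ∀ o, (ι o → X) → X → Prop} {n : ℕ}
    {S S' : Term X Ω ι} (h : Relax S S') : ∀ σ : Fin n → X, Typed ρ σ S → Typed ρ σ S' := by
  induction h with
  | leaf x => intro _ _; trivial
  | node o c j T _ ih =>
    rintro σ ⟨τ, h1, h2⟩
    refine ⟨τ, h1, fun i => ?_⟩
    by_cases hi : i = j
    · subst hi; simpa using ih _ (h2 i)
    · simpa [hi] using h2 i

/-- In the coordinates that no leaf refers to, the projection satisfies a typed formula. -/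
theorem Typed.mem_val [∀ o, Fintype (ι o)] {ρ : ∀ o, (ι o → X) → X → Prop} {n : ℕ} :
    ∀ (S : Term X Ω ι) (σ : Fin n → X), Typed ρ σ S →
      ∃ U : Finset (Fin n), U.card ≤ S.leaves ∧ ∀ i, i ∉ U → σ i ∈ S.val ρ
  | top, _, _ => ⟨∅, by simp, fun _ _ => trivial⟩
  | leaf x, σ, ⟨i, hi⟩ => ⟨{i}, by simp [leaves], fun j hj => hi j (by simpa using hj)⟩
  | node o c, σ, ⟨τ, h1, h2⟩ => by
      choose U hU hm using fun j => mem_val (c j) (τ j) (h2 j)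
      refine ⟨Finset.univ.biUnion U, Finset.card_biUnion_le.trans (Finset.sum_le_sum fun j _ => hU j),
        fun i hi => ⟨fun j => τ j i, h1 i, fun j => hm j i fun hj => hi ?_⟩⟩
      exact Finset.mem_biUnion.2 ⟨j, Finset.mem_univ _, hj⟩

section Closed

variable {ρ : ∀ o, (ι o → X) → X → Prop} {m : ℕ} {g : (Fin m → X) → X}

theorem val_closed (hg : IsNU g) (i₀ : Fin m)
    (hρ : ∀ o (t : Fin m → ι o → X) (y : Fin m → X), (∀ i, ρ o (t i) (y i)) →
      ρ o (fun j => g fun i => t i j) (g y)) :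
    ∀ (S : Term X Ω ι) (z : Fin m → X), (∀ i, z i ∈ S.val ρ) → g z ∈ S.val ρ
  | top, _, _ => trivial
  | leaf x, z, h => hg.eq_of_forall_ne i₀ fun j _ => h j
  | node o c, z, h => by
      choose t h1 h2 using h
      exact ⟨_, hρ o t z h1, fun j => val_closed hg i₀ hρ (c j) _ fun i => h2 i j⟩

/-- A tree formula absorbs each of its one-leaf relaxations. -/
theorem Relax.absorbs [∀ o, DecidableEq (ι o)] (hg : IsNU g)
    (hρ : ∀ o (t : Fin m → ι o → X) (y : Fin m → X), (∀ i, ρ o (t i) (y i)) →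
      ρ o (fun j => g fun i => t i j) (g y)) {S S' : Term X Ω ι} (h : Relax S S') :
    ∀ (j : Fin m) (z : Fin m → X), (∀ i, i ≠ j → z i ∈ S.val ρ) → z j ∈ S'.val ρ →
      g z ∈ S.val ρ := by
  induction h with
  | leaf x => intro j z h _; exact hg.eq_of_forall_ne j h
  | node o c l T _ ih =>
    intro j z h hj
    have : ∀ i, ∃ t, ρ o t (z i) ∧ (∀ a, a ≠ l → t a ∈ (c a).val ρ) ∧
        (i ≠ j → t l ∈ (c l).val ρ) ∧ (i = j → t l ∈ T.val ρ) := by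
      intro i
      by_cases hi : i = j
      · subst hi
        obtain ⟨t, h1, h2⟩ := hj
        refine ⟨t, h1, fun a ha => ?_, fun h => (h rfl).elim, fun _ => ?_⟩
        · simpa [ha] using h2 a
        · simpa using h2 l
      · obtain ⟨t, h1, h2⟩ := h i hi
        exact ⟨t, h1, fun a _ => h2 a, fun _ => h2 l, fun e => (hi e).elim⟩
    choose t h1 h2 h3 h4 using this
    refine ⟨_, hρ o t z h1, fun a => ?_⟩
    by_cases ha : a = l
    · subst ha
      exact ih j _ (fun i hi => h3 i hi) (h4 j rfl)
    · exact val_closed hg j hρ (c a) _ fun i => h2 i a ha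

end Closed

end Term

end NearUnanimity

/-! ### Bounding the leaves of critical formulas -/

namespace NearUnanimity

open Relation

/-- The state `(P, Q)` at an ancestor of a tree position with state `(P', Q')`, such that a leaf
hangs off the path between both positions: `δ` is the relation between the two positions, and
`δ'` the one after dropping that leaf. -/
def Visited {X : Type} {m : ℕ} (g : (Fin m → X) → X) (P' Q' P Q : Set X) : Prop :=
  ∃ δ δ' : X → X → Prop, AbsorbsRel g g δ δ' ∧ (∀ y, y ∈ P ↔ ∃ x ∈ P', δ x y) ∧
    (∀ x, x ∈ Q' ↔ ∃ y ∈ Q, δ x y) ∧ ∃ p ∈ P', ∃ q ∈ Q, δ' p q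

theorem exists_seq {X : Type} {P : Set X} {δ : X → X → Prop} (h : ∀ x ∈ P, ∃ y ∈ P, δ x y)
    {x : X} (hx : x ∈ P) : ∃ s : ℕ → X, s 0 = x ∧ (∀ i, s i ∈ P) ∧ ∀ i, δ (s i) (s (i + 1)) := by
  choose! F hF hδ using h
  have hP : ∀ i, F^[i] x ∈ P := by
    intro i
    induction i with
    | zero => exact hx
    | succ i ih => rw [Function.iterate_succ_apply']; exact hF _ ih
  refine ⟨fun i => F^[i] x, rfl, hP, fun i => ?_⟩
  simp only [Function.iterate_succ_apply']
  exact hδ _ (hP i)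

/-- Pumping: a state cannot be repeated along a path with a critical leaf in between. -/
theorem Visited.not_self {X : Type} {m : ℕ} {g : (Fin m → X) → X} {P Q : Set X}
    (hP : ∀ z : Fin m → X, (∀ i, z i ∈ P) → g z ∈ P)
    (hQ : ∀ z : Fin m → X, (∀ i, z i ∈ Q) → g z ∈ Q) (hd : Disjoint P Q) :
    ¬ Visited g P Q P Q := by
  rintro ⟨δ, δ', habs, h1, h2, p, hp, q, hq, hpq⟩
  -- A repeated state makes P its own `δ`-image and Q its own `δ`-preimage, so `δ`-walks extend
  -- forever backwards from `p` in P and forwards from `q` in Q. Absorption joins them into a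
  -- `δ`-walk from P to Q, which cannot leave P.
  obtain ⟨s, s0, sP, sδ⟩ := exists_seq (δ := fun x y => δ y x) (fun x hx => (h1 x).1 hx) hp
  obtain ⟨r, r0, rQ, rδ⟩ := exists_seq (δ := δ) (fun x hx => (h2 x).1 hx) hq
  have hw := habs.walk s r sδ (by rwa [s0, r0]) rδ
  have key : ∀ y, ReflTransGen δ (g fun i : Fin m => s i) y → y ∈ P := by
    intro y hy
    induction hy with
    | refl => exact hP _ fun i => sP i
    | tail _ hab ih => exact (h1 _).2 ⟨_, ih, hab⟩
  exact Set.disjoint_left.1 hd (key _ hw) (hQ _ fun i => rQ _)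

/-- A disjoint pair amounts to a map to three labels: in the first set, in the second, in neither.
-/
theorem card_disjoint_pairs_le {X : Type} [Fintype X] (𝒳 : Finset (Set X × Set X))
    (h : ∀ s ∈ 𝒳, Disjoint s.1 s.2) : 𝒳.card ≤ 3 ^ Fintype.card X := by
  classical
  have hc : (Finset.univ : Finset (X → Fin 3)).card = 3 ^ Fintype.card X := by simp
  rw [← hc]
  refine Finset.card_le_card_of_injOn
    (fun s x => if x ∈ s.1 then 0 else if x ∈ s.2 then 1 else 2) 
    (fun _ _ => Finset.mem_coe.2 (Finset.mem_univ _)) ?_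
  rintro ⟨P, Q⟩ hs ⟨P', Q'⟩ hs' e
  have d := Set.disjoint_left.1 (h _ hs)
  have d' := Set.disjoint_left.1 (h _ hs')
  simp only at d d'
  have e' : ∀ x, (x ∈ P ↔ x ∈ P') ∧ (x ∈ Q ↔ x ∈ Q') := by
    intro x
    have := congrFun e x
    have dx := @d x
    have dx' := @d' x
    by_cases h1 : x ∈ P <;> by_cases h2 : x ∈ Q <;> by_cases h3 : x ∈ P' <;>
      by_cases h4 : x ∈ Q' <;> simp_all
  exact Prod.ext (Set.ext fun x => (e' x).1) (Set.ext fun x => (e' x).2)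

namespace Term

variable {X Ω : Type} {ι : Ω → Type} {ρ : ∀ o, (ι o → X) → X → Prop} {m : ℕ}
  {g : (Fin m → X) → X}

/-- A formula all of whose leaves are needed to refute it has boundedly many leaves. -/
theorem leaves_mul_pow_le [Fintype X] [∀ o, Fintype (ι o)] [∀ o, DecidableEq (ι o)]
    (hg : IsNU g) (i₀ : Fin m)
    (hρ : ∀ o (t : Fin m → ι o → X) (y : Fin m → X), (∀ i, ρ o (t i) (y i)) →
      ρ o (fun j => g fun i => t i j) (g y))
    {β : ℕ} (hβ : 1 ≤ β) (hι : ∀ o, Fintype.card (ι o) ≤ β) (S : Term X Ω ι) :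
    ∀ (Q : Set X) (𝒳 : Finset (Set X × Set X)),
      (∀ z : Fin m → X, (∀ i, z i ∈ Q) → g z ∈ Q) → Disjoint (S.val ρ) Q →
      (∀ S', Relax S S' → (S'.val ρ ∩ Q).Nonempty) →
      (∀ s ∈ 𝒳, Disjoint s.1 s.2 ∧ Visited g (S.val ρ) Q s.1 s.2) →
      S.leaves * β ^ 𝒳.card ≤ β ^ 3 ^ Fintype.card X := by
  classical
  -- `𝒳` collects the states at ancestors where a leaf branches off the path to the current node.
  -- Each real branching adds a new state, which pays for a factor `β` in the number of leaves.
  induction S with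
  | top => intros; simp [leaves]
  | leaf x =>
    intro Q 𝒳 _ _ _ h𝒳
    simpa [leaves] using
      Nat.pow_le_pow_right hβ (card_disjoint_pairs_le 𝒳 fun s hs => (h𝒳 s hs).1)
  | node o c ih =>
    intro Q 𝒳 hQ hd hcrit h𝒳
    have hP := val_closed hg i₀ hρ (node o c)
    -- the acceptance set of the child `j` and the relation between the child and the root
    let σ : ι o → X → X → Prop := fun j x y =>
      ∃ t, ρ o t y ∧ t j = x ∧ ∀ a, a ≠ j → t a ∈ (c a).val ρ
    have hσabs : ∀ j, AbsorbsRel g g (σ j) (σ j) := by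
      intro j l u v h1 h2
      have : ∀ i, σ j (u i) (v i) := fun i => by
        by_cases hi : i = l
        · rw [hi]; exact h2
        · exact h1 i hi
      choose t h1 h2 h3 using this
      exact ⟨_, hρ o t v h1, by simp [h2],
        fun a ha => val_closed hg i₀ hρ (c a) _ fun i => h3 i a ha⟩
    -- The values at child `j` that the rest of the whole tree accepts.
    let Qc : ι o → Set X := fun j => {x | ∃ y ∈ Q, σ j x y}
    have hval : ∀ j y, y ∈ (node o c).val ρ ↔ ∃ x ∈ (c j).val ρ, σ j x y := by
      intro j y
      constructor
      · rintro ⟨t, h1, h2⟩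
        exact ⟨t j, h2 j, t, h1, rfl, fun a _ => h2 a⟩
      · rintro ⟨x, hx, t, h1, h2, h3⟩
        refine ⟨t, h1, fun a => ?_⟩
        by_cases ha : a = j
        · subst ha; rw [h2]; exact hx
        · exact h3 a ha
    have hQc : ∀ j (z : Fin m → X), (∀ i, z i ∈ Qc j) → g z ∈ Qc j := by
      intro j z hz
      choose y hy hs using hz
      exact ⟨g y, hQ y hy, hσabs j i₀ z y (fun i _ => hs i) (hs i₀)⟩
    have hdc : ∀ j, Disjoint ((c j).val ρ) (Qc j) := by
      intro j
      refine Set.disjoint_left.2 ?_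
      rintro x hx ⟨y, hy, hs⟩
      exact Set.disjoint_left.1 hd ((hval j y).2 ⟨x, hx, hs⟩) hy
    have hcritc : ∀ j S', Relax (c j) S' → (S'.val ρ ∩ Qc j).Nonempty := by
      intro j S' hS
      obtain ⟨y, ⟨t, h1, h2⟩, hy⟩ := hcrit _ (.node o c j S' hS)
      exact ⟨t j, by simpa using h2 j, y, hy, t, h1, rfl, fun a ha => by simpa [ha] using h2 a⟩
    have hlift : ∀ j, ∀ s ∈ 𝒳, Disjoint s.1 s.2 ∧ Visited g ((c j).val ρ) (Qc j) s.1 s.2 := by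
      intro j s hs
      obtain ⟨hds, δ, δ', habs, h1, h2, p, hp, q, hq, hpq⟩ := h𝒳 s hs
      refine ⟨hds, fun x z => ∃ y, σ j x y ∧ δ y z, fun x z => ∃ y, σ j x y ∧ δ' y z,
        ?_, ?_, ?_, ?_⟩
      · intro l u v ha hb
        obtain ⟨yl, hl, hl'⟩ := hb
        have : ∀ i, ∃ y, σ j (u i) y ∧ (i ≠ l → δ y (v i)) ∧ (i = l → δ' y (v i)) := by
          intro i
          by_cases hi : i = l
          · subst hi; exact ⟨yl, hl, fun h => (h rfl).elim, fun _ => hl'⟩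
          · obtain ⟨y, hy, hy'⟩ := ha i hi
            exact ⟨y, hy, fun _ => hy', fun h => (hi h).elim⟩
        choose y hy hy1 hy2 using this
        exact ⟨g y, hσabs j l u y (fun i _ => hy i) (hy l), habs l y v hy1 (hy2 l rfl)⟩
      · intro z
        rw [h1]
        constructor
        · rintro ⟨y, hy, hyz⟩
          obtain ⟨x, hx, hxy⟩ := (hval j y).1 hy
          exact ⟨x, hx, y, hxy, hyz⟩
        · rintro ⟨x, hx, y, hxy, hyz⟩
          exact ⟨y, (hval j y).2 ⟨x, hx, hxy⟩, hyz⟩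
      · intro x
        constructor
        · rintro ⟨y, hy, hxy⟩
          obtain ⟨z, hz, hyz⟩ := (h2 y).1 hy
          exact ⟨z, hz, y, hxy, hyz⟩
        · rintro ⟨z, hz, y, hxy, hyz⟩
          exact ⟨y, (h2 y).2 ⟨z, hz, hyz⟩, hxy⟩
      · obtain ⟨x, hx, hxp⟩ := (hval j p).1 hp
        exact ⟨x, hx, q, hq, p, hxp, hpq⟩
    have hnew : ((node o c).val ρ, Q) ∉ 𝒳 := fun hmem =>
      Visited.not_self hP hQ hd (h𝒳 _ hmem).2
    by_cases htwo : ∃ j₁ j₂, j₁ ≠ j₂ ∧ (c j₁).leaves ≠ 0 ∧ (c j₂).leaves ≠ 0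
    · have hother : ∀ j, ∃ l, l ≠ j ∧ (c l).leaves ≠ 0 := by
        obtain ⟨j₁, j₂, hne, h1, h2⟩ := htwo
        intro j
        by_cases hj : j₁ = j
        · exact ⟨j₂, fun e => hne (hj.trans e.symm), h2⟩
        · exact ⟨j₁, hj, h1⟩
      -- Some sibling of `j` carries a leaf, so the present state joins `𝒳`; it is new by pumping.
      -- Dropping that leaf gives the required `δ'`, and criticality supplies its witnesses.
      have hchild : ∀ j, (c j).leaves * β ^ (𝒳.card + 1) ≤ β ^ 3 ^ Fintype.card X := by
        intro j
        have hins := ih j (Qc j) (insert ((node o c).val ρ, Q) 𝒳) (hQc j) (hdc j) (hcritc j) ?_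
        · rwa [Finset.card_insert_of_notMem hnew] at hins
        intro s hs
        rcases Finset.mem_insert.1 hs with rfl | hs
        swap
        · exact hlift j s hs
        refine ⟨hd, ?_⟩
        obtain ⟨l, hlj, hl⟩ := hother j
        obtain ⟨S', hS'⟩ := exists_relax (c l) hl
        refine ⟨σ j, fun x y => ∃ t, ρ o t y ∧ t j = x ∧ t l ∈ S'.val ρ ∧
          ∀ a, a ≠ j → a ≠ l → t a ∈ (c a).val ρ, ?_, hval j, fun _ => Iff.rfl, ?_⟩
        · intro i₁ u v ha hb
          have : ∀ i, ∃ t, ρ o t (v i) ∧ t j = u i ∧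
              (∀ a, a ≠ j → a ≠ l → t a ∈ (c a).val ρ) ∧
              (i ≠ i₁ → t l ∈ (c l).val ρ) ∧ (i = i₁ → t l ∈ S'.val ρ) := by
            intro i
            by_cases hi : i = i₁
            · subst hi
              obtain ⟨t, q1, q2, q3, q4⟩ := hb
              exact ⟨t, q1, q2, q4, fun h => (h rfl).elim, fun _ => q3⟩
            · obtain ⟨t, q1, q2, q3⟩ := ha i hi
              exact ⟨t, q1, q2, fun a h _ => q3 a h, fun _ => q3 l hlj, fun h => (hi h).elim⟩
          choose t q1 q2 q3 q4 q5 using this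
          refine ⟨_, hρ o t v q1, by simp [q2], fun a haj => ?_⟩
          by_cases hal : a = l
          · subst hal
            exact hS'.absorbs hg hρ i₁ _ q4 (q5 i₁ rfl)
          · exact val_closed hg i₀ hρ (c a) _ fun i => q3 i a haj hal
        · obtain ⟨y, ⟨t, h1, h2⟩, hy⟩ := hcrit _ (.node o c l S' hS')
          refine ⟨t j, by simpa [hlj.symm] using h2 j, y, hy, t, h1, rfl, by simpa using h2 l,
            fun a _ hal => by simpa [hal] using h2 a⟩
      have hsum : (∑ j, (c j).leaves) * β ^ (𝒳.card + 1) ≤ β * β ^ 3 ^ Fintype.card X := by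
        rw [Finset.sum_mul]
        calc _ ≤ ∑ _j : ι o, β ^ 3 ^ Fintype.card X := Finset.sum_le_sum fun j _ => hchild j
          _ = Fintype.card (ι o) * β ^ 3 ^ Fintype.card X := by simp
          _ ≤ _ := Nat.mul_le_mul_right _ (hι o)
      refine le_of_mul_le_mul_left ?_ (Nat.lt_of_lt_of_le Nat.zero_lt_one hβ)
      calc β * ((∑ j, (c j).leaves) * β ^ 𝒳.card)
          = (∑ j, (c j).leaves) * β ^ (𝒳.card + 1) := by ring
        _ ≤ _ := hsum
    -- Without two leaf-bearing children there is no branching, and `𝒳` stays unchanged.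
    · push Not at htwo
      by_cases hone : ∃ j, (c j).leaves ≠ 0
      · obtain ⟨j, hj⟩ := hone
        have : (node o c).leaves = (c j).leaves := by
          refine Finset.sum_eq_single j (fun l _ hl => htwo j l hl.symm hj) (by simp)
        rw [this]
        exact ih j (Qc j) 𝒳 (hQc j) (hdc j) (hcritc j) (hlift j)
      · push Not at hone
        have : (node o c).leaves = 0 := Finset.sum_eq_zero fun j _ => hone j
        simp [this]

/-- Tree formulas in the indicator instance of a large power are satisfiable. -/
theorem Typed.val_nonempty [Fintype X] [∀ o, Fintype (ι o)]
    (hg : IsNU g) (i₀ : Fin m)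
    (hρ : ∀ o (t : Fin m → ι o → X) (y : Fin m → X), (∀ i, ρ o (t i) (y i)) →
      ρ o (fun j => g fun i => t i j) (g y))
    {β : ℕ} (hβ : 1 ≤ β) (hι : ∀ o, Fintype.card (ι o) ≤ β)
    {n : ℕ} (hn : β ^ 3 ^ Fintype.card X < n) (σ : Fin n → X) (S : Term X Ω ι)
    (hS : Typed ρ σ S) : (S.val ρ).Nonempty := by
  classical
  induction hN : S.leaves using Nat.strong_induction_on generalizing S with
  | _ N ih =>
    -- By induction all relaxations are satisfiable, so an unsatisfiable `S` is critical with Q the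
    -- whole set.
    by_contra hempty
    have hcrit : ∀ S', Relax S S' → (S'.val ρ ∩ Set.univ).Nonempty := fun S' h => by
      rw [Set.inter_univ]
      exact ih _ (hN ▸ h.leaves_lt) S' (h.typed σ hS) rfl
    have hle := leaves_mul_pow_le hg i₀ hρ hβ hι S Set.univ ∅ (fun _ _ => trivial)
      (by rw [Set.not_nonempty_iff_eq_empty.1 hempty]; exact Set.empty_disjoint _) hcrit (by simp)
    obtain ⟨U, hU, hmem⟩ := hS.mem_val S σ
    have : ∃ i, i ∉ U := by
      by_contra hall
      push Not at hall
      have := Finset.card_le_card (fun i _ => hall i : (Finset.univ : Finset (Fin n)) ⊆ U)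
      simp at this hle
      omega
    obtain ⟨i, hi⟩ := this
    exact hempty ⟨_, hmem i hi⟩

end Term

end NearUnanimity

/-! ### Patterns, walks and reversibility -/

namespace NearUnanimity

open Relation

/-- Sequences of edges leading from one node to another. -/
inductive Pattern {N : Type} (E : N → N → Type) : N → N → Type
  | nil (u : N) : Pattern E u u
  | cons {u v w : N} (e : E u v) (p : Pattern E v w) : Pattern E u w

namespace Pattern

variable {N : Type} {E : N → N → Type}

/-- Concatenation of patterns. -/
def append : {u v w : N} → Pattern E u v → Pattern E v w → Pattern E u w
  | _, _, _, nil _, q => q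
  | _, _, _, cons e p, q => cons e (append p q)

theorem append_nil : ∀ {u v : N} (p : Pattern E u v), p.append (nil v) = p
  | _, _, nil _ => rfl
  | _, _, cons e p => congrArg (cons e) p.append_nil

theorem append_assoc : ∀ {u v w x : N} (p : Pattern E u v) (q : Pattern E v w)
    (r : Pattern E w x), (p.append q).append r = p.append (q.append r)
  | _, _, _, _, nil _, _, _ => rfl
  | _, _, _, _, cons e p, q, r => congrArg (cons e) (append_assoc p q r)

/-- Iteration of a closed pattern. -/
def iter {u : N} (s : Pattern E u u) : ℕ → Pattern E u u
  | 0 => nil u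
  | n + 1 => s.append (s.iter n)

theorem iter_add {u : N} (s : Pattern E u u) (i j : ℕ) :
    s.iter (i + j) = (s.iter i).append (s.iter j) := by
  induction i with
  | zero => simp [iter, append]
  | succ i ih => rw [Nat.succ_add]; simp only [iter, ih, append_assoc]

theorem iter_one {u : N} (s : Pattern E u u) : s.iter 1 = s := s.append_nil

variable {D : N → Type} (R : ∀ ⦃u v : N⦄, E u v → D u → D v → Prop)

/-- `p.rel R A a b`: there is a walk from `a` to `b` along `p` inside the domains `A`. -/
def rel (A : ∀ u, Set (D u)) : {u v : N} → Pattern E u v → D u → D v → Prop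
  | _, _, nil u, a, b => a = b ∧ a ∈ A u
  | _, _, cons (u := u) e p, a, b => a ∈ A u ∧ ∃ c, R e a c ∧ rel A p c b

variable {R} {A A' : ∀ u, Set (D u)}

theorem rel_left : ∀ {u v : N} {p : Pattern E u v} {a : D u} {b : D v},
    p.rel R A a b → a ∈ A u
  | _, _, nil _, _, _, h => h.2
  | _, _, cons _ _, _, _, h => h.1

theorem rel_right : ∀ {u v : N} {p : Pattern E u v} {a : D u} {b : D v},
    p.rel R A a b → b ∈ A v
  | _, _, nil _, _, _, h => h.1 ▸ h.2
  | _, _, cons _ _, _, _, h => let ⟨_, _, _, h'⟩ := h; rel_right h'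

theorem rel_append : ∀ {u v w : N} {p : Pattern E u v} {q : Pattern E v w} {a : D u} {c : D w},
    (p.append q).rel R A a c ↔ ∃ b, p.rel R A a b ∧ q.rel R A b c
  | _, _, _, nil _, q, a, c => by
      simp only [append, rel]
      constructor
      · intro h; exact ⟨a, ⟨rfl, rel_left h⟩, h⟩
      · rintro ⟨b, ⟨rfl, _⟩, h⟩; exact h
  | _, _, _, cons e p, q, a, c => by
      simp only [append, rel, rel_append]
      constructor
      · rintro ⟨h, d, hd, b, h1, h2⟩; exact ⟨b, ⟨h, d, hd, h1⟩, h2⟩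
      · rintro ⟨b, ⟨h, d, hd, h1⟩, h2⟩; exact ⟨h, d, hd, b, h1, h2⟩

theorem rel_mono (hA : ∀ u, A' u ⊆ A u) : ∀ {u v : N} {p : Pattern E u v} {a : D u} {b : D v},
    p.rel R A' a b → p.rel R A a b
  | _, _, nil _, _, _, h => ⟨h.1, hA _ h.2⟩
  | _, _, cons _ _, _, _, h => let ⟨h₁, c, hc, h₂⟩ := h; ⟨hA _ h₁, c, hc, rel_mono hA h₂⟩

theorem reflTransGen_of_rel_iter {u : N} {s : Pattern E u u} {n : ℕ} {a b : D u}
    (h : (s.iter n).rel R A a b) : ReflTransGen (s.rel R A) a b := by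
  induction n generalizing a with
  | zero => rw [h.1]
  | succ n ih =>
    obtain ⟨c, h1, h2⟩ := rel_append.1 h
    exact (ih h2).head h1

theorem exists_rel_iter_mul {u : N} {s : Pattern E u u} {l : ℕ} {a b : D u} (ha : a ∈ A u)
    (h : ReflTransGen ((s.iter l).rel R A) a b) : ∃ j, (s.iter (l * j)).rel R A a b := by
  induction h with
  | refl => exact ⟨0, rfl, ha⟩
  | tail _ hbc ih =>
    obtain ⟨j, hj⟩ := ih
    exact ⟨j + 1, by rw [Nat.mul_succ, iter_add]; exact rel_append.2 ⟨_, hj, hbc⟩⟩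

theorem exists_rel_iter {u : N} {s : Pattern E u u} {a b : D u} (ha : a ∈ A u)
    (h : ReflTransGen (s.rel R A) a b) : ∃ j, (s.iter j).rel R A a b := by
  rw [← s.iter_one] at h
  obtain ⟨j, hj⟩ := exists_rel_iter_mul ha h
  exact ⟨_, hj⟩

theorem exists_rel_iter_succ {u : N} {s : Pattern E u u} {a b : D u}
    (h : TransGen (s.rel R A) a b) : ∃ j, (s.iter (j + 1)).rel R A a b := by
  obtain ⟨c, h1, h2⟩ := TransGen.head'_iff.1 h
  obtain ⟨j, hj⟩ := exists_rel_iter (rel_right h1) h2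
  exact ⟨j, rel_append.2 ⟨c, h1, hj⟩⟩

theorem rel_iter_mul_self {u : N} {s : Pattern E u u} {l : ℕ} {a : D u}
    (h : (s.iter l).rel R A a a) (j : ℕ) : (s.iter (l * j)).rel R A a a := by
  induction j with
  | zero => exact ⟨rfl, rel_left h⟩
  | succ j ih => rw [Nat.mul_succ, iter_add]; exact rel_append.2 ⟨_, ih, h⟩

/-- Apply `g` vertex by vertex to `m` walks, only the `j`-th of which may leave `A'`. The case `A' =
A` says that walk relations are closed under `g`. -/
theorem absorbsRel_rel {m : ℕ} {g : ∀ u, (Fin m → D u) → D u}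
    (hR : ∀ ⦃u v⦄ (e : E u v) (a : Fin m → D u) (b : Fin m → D v),
      (∀ i, R e (a i) (b i)) → R e (g u a) (g v b))
    (habs : ∀ u (j : Fin m) (z : Fin m → D u), (∀ i, i ≠ j → z i ∈ A' u) → z j ∈ A u →
      g u z ∈ A' u) :
    ∀ {u v : N} (p : Pattern E u v), AbsorbsRel (g u) (g v) (p.rel R A') (p.rel R A)
  | _, _, nil u, j, x, y, h1, h2 => by
      have : x = y := funext fun i => by
        by_cases hi : i = j
        · rw [hi]; exact h2.1
        · exact (h1 i hi).1
      subst this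
      exact ⟨rfl, habs u j x (fun i hi => (h1 i hi).2) h2.2⟩
  | _, _, cons (u := u) (v := v) e p, j, x, y, h1, h2 => by
      have : ∀ i, ∃ c, R e (x i) c ∧ (i ≠ j → p.rel R A' c (y i)) ∧
          (i = j → p.rel R A c (y i)) := by
        intro i
        by_cases hi : i = j
        · subst hi
          obtain ⟨_, c, q1, q2⟩ := h2
          exact ⟨c, q1, fun h => (h rfl).elim, fun _ => q2⟩
        · obtain ⟨_, c, q1, q2⟩ := h1 i hi
          exact ⟨c, q1, fun _ => q2, fun h => (hi h).elim⟩
      choose c q1 q2 q3 using this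
      exact ⟨habs u j x (fun i hi => (h1 i hi).1) h2.1, g v c, hR e x c q1,
        absorbsRel_rel hR habs p j c y q2 (q3 j rfl)⟩

end Pattern

section Instance

variable {N : Type} {E : N → N → Type} {D : N → Type}
  (R : ∀ ⦃u v : N⦄, E u v → D u → D v → Prop)

/-- Every value of a domain extends along every edge. -/
def ArcConsistent (A : ∀ u, Set (D u)) : Prop :=
  ∀ ⦃u v : N⦄ (e : E u v), ∀ a ∈ A u, ∃ b ∈ A v, R e a b

/-- A walk along a closed pattern `p` can be undone by iterating any closed pattern that
begins with `p`. -/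
def Reversible (A : ∀ u, Set (D u)) : Prop :=
  ∀ (u : N) (p q : Pattern E u u) (a b : D u), p.rel R A a b →
    ReflTransGen ((p.append q).rel R A) b a

/-- The edge relations come in mutually inverse pairs. -/
def HasInverses : Prop :=
  ∀ ⦃u v : N⦄ (e : E u v), ∃ e' : E v u, ∀ a b, R e a b ↔ R e' b a

variable {R} {A : ∀ u, Set (D u)}

theorem ArcConsistent.exists_right (h : ArcConsistent R A) :
    ∀ {u v : N} (p : Pattern E u v) {a : D u}, a ∈ A u → ∃ b, p.rel R A a b
  | _, _, .nil _, a, ha => ⟨a, rfl, ha⟩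
  | _, _, .cons e p, a, ha => by
      obtain ⟨c, hc, hac⟩ := h e a ha
      obtain ⟨b, hb⟩ := h.exists_right p hc
      exact ⟨b, ha, c, hac, hb⟩

theorem ArcConsistent.exists_left (h : ArcConsistent R A) (hinv : HasInverses R) :
    ∀ {u v : N} (p : Pattern E u v) {b : D v}, b ∈ A v → ∃ a, p.rel R A a b
  | _, _, .nil _, b, hb => ⟨b, rfl, hb⟩
  | _, _, .cons e p, b, hb => by
      obtain ⟨c, hc⟩ := h.exists_left hinv p hb
      obtain ⟨e', he'⟩ := hinv e
      obtain ⟨a, ha, hca⟩ := h e' c (Pattern.rel_left hc)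
      exact ⟨a, ha, c, (he' a c).2 hca, hc⟩

/-- If every edge is contained in the inverse of every pattern leading back, then walks along
closed patterns are reversible. -/
theorem reversible_of_edge (hac : ArcConsistent R A)
    (h : ∀ ⦃u v : N⦄ (e : E u v) (r : Pattern E v u), ∀ a ∈ A u, ∀ b ∈ A v, R e a b →
      r.rel R A b a) : Reversible R A := by
  have hrefl : ∀ {u : N} (p : Pattern E u u), ∀ a ∈ A u, p.rel R A a a := by
    intro u p a ha
    cases p with
    | nil => exact ⟨rfl, ha⟩
    | cons e r =>
      obtain ⟨b, hb, hab⟩ := hac e a ha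
      exact ⟨ha, b, hab, h e r a ha b hb hab⟩
  intro u p q a b hab
  -- Induction on a suffix `p₂` of `p`: iterating `p.append q` from `b` reaches a point with a
  -- `p₁`-walk to the start `c` of the suffix. For `p₂ = p` this point is `a`. The equation `hv`
  -- frees the endpoint for the induction.
  have key : ∀ {w v : N} (p₂ : Pattern E w v) (hv : v = u) (p₁ : Pattern E u w),
      p₁.append (hv ▸ p₂) = p → ∀ c, (hv ▸ p₂ : Pattern E w u).rel R A c b →
      ∃ x, ReflTransGen ((p.append q).rel R A) b x ∧ p₁.rel R A x c := by
    intro w v p₂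
    induction p₂ with
    | nil w =>
      rintro rfl p₁ hp c hc
      obtain rfl : c = b := hc.1
      exact ⟨c, .refl, hrefl _ _ hc.2⟩
    | @cons w w' v e p₂ ih =>
      rintro rfl p₁ hp c ⟨hc, d, hcd, hdb⟩
      obtain ⟨x, hx, hxd⟩ := ih rfl (p₁.append (.cons e (.nil _)))
        (by rw [Pattern.append_assoc]; exact hp) d hdb
      have hback := h e (p₂.append (q.append p₁)) c hc d (Pattern.rel_left hdb) hcd
      rw [← Pattern.append_assoc] at hback
      obtain ⟨y, hdy, hyc⟩ := Pattern.rel_append.1 hback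
      refine ⟨y, hx.tail ?_, hyc⟩
      have e1 : p.append q = (p₁.append (.cons e (.nil _))).append (p₂.append q) := by
        rw [← hp]; simp only [Pattern.append_assoc, Pattern.append]
      rw [e1]
      exact Pattern.rel_append.2 ⟨d, hxd, hdy⟩
  obtain ⟨x, hx, hxa⟩ := key p rfl (.nil u) rfl a hab
  rwa [hxa.1] at hx

end Instance

end NearUnanimity

/-! ### Absorbing subdomains -/

namespace NearUnanimity

open Relation

theorem reflTransGen_of_forall {X : Type} {r δ : X → X → Prop} {a b : X}
    (hab : ReflTransGen r a b) (h : ∀ x y, r x y → ReflTransGen δ x y) : ReflTransGen δ a b := by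
  induction hab with
  | refl => exact .refl
  | tail _ hbc ih => exact ih.trans (h _ _ hbc)

/-- In a finite set with a serial relation, every element reaches a recurrent one. -/
theorem exists_reflTransGen_transGen_self {X : Type} [Finite X] {P : Set X} {δ : X → X → Prop}
    (h : ∀ x ∈ P, ∃ y ∈ P, δ x y) {x : X} (hx : x ∈ P) :
    ∃ y, ReflTransGen δ x y ∧ TransGen δ y y := by
  obtain ⟨s, rfl, -, hs⟩ := exists_seq h hx
  have hle : ∀ i j, ReflTransGen δ (s i) (s (i + j)) := by
    intro i j
    induction j with
    | zero => exact .refl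
    | succ j ih => exact ih.tail (hs _)
  obtain ⟨i, j, hne, hij⟩ := Finite.exists_ne_map_eq_of_infinite s
  wlog hlt : i < j generalizing i j
  · exact this j i hne.symm hij.symm (by omega)
  refine ⟨s i, by simpa using hle 0 i, ?_⟩
  have h1 := hle (i + 1) (j - (i + 1))
  rw [show i + 1 + (j - (i + 1)) = j by omega, ← hij] at h1
  exact TransGen.head' (hs i) h1

section Reduction

variable {N : Type} {E : N → N → Type} {D : N → Type}
  {R : ∀ ⦃u v : N⦄, E u v → D u → D v → Prop} {A A' : ∀ u, Set (D u)}
  {m : ℕ} {g : ∀ u, (Fin m → D u) → D u}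

/-- Reversibility is inherited by arc consistent absorbing subdomains. -/
theorem Reversible.of_absorbing [∀ u, Finite (D u)] (i₀ : Fin m) (hg : ∀ u, IsNU (g u))
    (hR : ∀ ⦃u v⦄ (e : E u v) (a : Fin m → D u) (b : Fin m → D v),
      (∀ i, R e (a i) (b i)) → R e (g u a) (g v b))
    (hinv : HasInverses R) (hrev : Reversible R A) (hsub : ∀ u, A' u ⊆ A u)
    (habs : ∀ u (j : Fin m) (z : Fin m → D u), (∀ i, i ≠ j → z i ∈ A' u) → z j ∈ A u →
      g u z ∈ A' u)
    (hac : ArcConsistent R A') : Reversible R A' := by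
  -- Loops at `a` and `b` inside `A'` serve as the infinite `δ`-walks, so one walk through `A` is
  -- replaced by walks inside `A'`.
  have key : ∀ {u : N} (s : Pattern E u u) (l : ℕ) (a b : D u), (s.iter l).rel R A' a a →
      (s.iter l).rel R A a b → (s.iter l).rel R A' b b → ReflTransGen (s.rel R A') a b := by
    intro u s l a b h1 h2 h3
    have := (Pattern.absorbsRel_rel hR habs (s.iter l)).walk (fun _ => a) (fun _ => b)
      (fun _ => h1) h2 (fun _ => h3)
    rw [(hg u).const i₀, (hg u).const i₀] at this
    exact reflTransGen_of_forall this fun x y hxy => Pattern.reflTransGen_of_rel_iter hxy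
  -- two recurrent points of the restricted instance
  have key' : ∀ {u : N} (s : Pattern E u u) (l₁ l₂ : ℕ) (a b : D u),
      (s.iter l₁).rel R A' a a → (s.iter l₂).rel R A' b b →
      (∃ l, ReflTransGen ((s.iter (l * (l₁ * l₂))).rel R A) a b) →
      ReflTransGen (s.rel R A') a b := by
    rintro u s l₁ l₂ a b h1 h2 ⟨l, hl⟩
    obtain ⟨j, hj⟩ := Pattern.exists_rel_iter_mul (hsub _ (Pattern.rel_left h1)) hl
    refine key s _ a b ?_ hj ?_
    · rw [show l * (l₁ * l₂) * j = l₁ * (l * l₂ * j) by ring]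
      exact Pattern.rel_iter_mul_self h1 _
    · rw [show l * (l₁ * l₂) * j = l₂ * (l * l₁ * j) by ring]
      exact Pattern.rel_iter_mul_self h2 _
  -- Go forward from `b` to a recurrent `b₁`, return in `A` to a recurrent `a₁` that reaches `a`,
  -- and pull this return into `A'` by `key'`.
  have hstep : ∀ {u : N} (s : Pattern E u u) (a b : D u), s.rel R A' a b →
      ReflTransGen (s.rel R A') b a := by
    intro u s a b hab
    obtain ⟨b₁, hb₁, hb₁'⟩ := exists_reflTransGen_transGen_self (P := A' u) (δ := s.rel R A')
      (fun x hx => (hac.exists_right s hx).imp fun y hy => ⟨Pattern.rel_right hy, hy⟩)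
      (Pattern.rel_right hab)
    obtain ⟨a₁, ha₁, ha₁'⟩ := exists_reflTransGen_transGen_self (P := A' u)
      (δ := Function.swap (s.rel R A'))
      (fun x hx => (hac.exists_left hinv s hx).imp fun y hy => ⟨Pattern.rel_left hy, hy⟩)
      (Pattern.rel_left hab)
    rw [reflTransGen_swap] at ha₁
    rw [transGen_swap] at ha₁'
    obtain ⟨l₁, hl₁⟩ := Pattern.exists_rel_iter_succ hb₁'
    obtain ⟨l₂, hl₂⟩ := Pattern.exists_rel_iter_succ ha₁'
    obtain ⟨l, hl⟩ := Pattern.exists_rel_iter (Pattern.rel_left hl₂)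
      ((ha₁.tail hab).trans hb₁)
    refine (hb₁.trans (key' s _ _ b₁ a₁ hl₁ hl₂ ⟨l, ?_⟩)).trans ha₁
    -- The padding makes the length a multiple of both loop lengths `l₁ + 1` and `l₂ + 1`.
    have := hrev u (s.iter l) (s.iter (l * (l₁ * l₂ + l₁ + l₂))) a₁ b₁ (Pattern.rel_mono hsub hl)
    rwa [← Pattern.iter_add,
      show l + l * (l₁ * l₂ + l₁ + l₂) = l * ((l₁ + 1) * (l₂ + 1)) by ring] at this
  intro u p q a b hab
  have hrec : ∀ x ∈ A' u, ∃ l, ((p.append q).iter (l + 1)).rel R A' x x := by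
    intro x hx
    obtain ⟨y, hy⟩ := hac.exists_right (p.append q) hx
    exact Pattern.exists_rel_iter_succ (TransGen.head' hy (hstep _ _ _ hy))
  obtain ⟨l₁, hl₁⟩ := hrec b (Pattern.rel_right hab)
  obtain ⟨l₂, hl₂⟩ := hrec a (Pattern.rel_left hab)
  refine key' _ _ _ b a hl₁ hl₂ ⟨1, ?_⟩
  have := hrev u p (q.append ((p.append q).iter (l₁ * l₂ + l₁ + l₂))) a b
    (Pattern.rel_mono hsub hab)
  rw [← Pattern.append_assoc] at this
  rwa [show 1 * ((l₁ + 1) * (l₂ + 1)) = (l₁ * l₂ + l₁ + l₂) + 1 by ring]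

variable (R A) in
/-- The set of endpoints of the walks along `p` that start in `B`. -/
def image {u v : N} (p : Pattern E u v) (B : Set (D u)) : Set (D v) :=
  {b | ∃ a ∈ B, p.rel R A a b}

theorem image_append {u v w : N} (p : Pattern E u v) (q : Pattern E v w) (B : Set (D u)) :
    image R A (p.append q) B = image R A q (image R A p B) := by
  ext c
  simp only [image, Pattern.rel_append, Set.mem_ofPred_eq]
  constructor
  · rintro ⟨a, ha, b, h1, h2⟩; exact ⟨b, ⟨a, ha, h1⟩, h2⟩
  · rintro ⟨b, ⟨a, ha, h1⟩, h2⟩; exact ⟨a, ha, b, h1, h2⟩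

variable (A g) in
/-- Nonempty proper absorbing subsets of a domain. -/
structure IsProperAbsorbing (u : N) (B : Set (D u)) : Prop where
  subset : B ⊆ A u
  nonempty : B.Nonempty
  ne : B ≠ A u
  absorbs : ∀ (j : Fin m) (z : Fin m → D u), (∀ i, i ≠ j → z i ∈ B) → z j ∈ A u → g u z ∈ B

/-- The one argument outside the image still has a walk from `A u` by arc consistency and inverse
edges, and `B` absorbs its starting point. An image may fill the domain, so `hne` is needed. -/
theorem IsProperAbsorbing.image (hR : ∀ ⦃u v⦄ (e : E u v) (a : Fin m → D u) (b : Fin m → D v),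
      (∀ i, R e (a i) (b i)) → R e (g u a) (g v b)) (hinv : HasInverses R)
    (hcl : ∀ u (z : Fin m → D u), (∀ i, z i ∈ A u) → g u z ∈ A u)
    (hac : ArcConsistent R A) {u v : N} {B : Set (D u)} (hB : IsProperAbsorbing A g u B)
    (p : Pattern E u v) (hne : image R A p B ≠ A v) :
    IsProperAbsorbing A g v (image R A p B) where
  subset := by rintro b ⟨a, _, h⟩; exact Pattern.rel_right h
  nonempty := by
    obtain ⟨a, ha⟩ := hB.nonempty
    obtain ⟨b, hb⟩ := hac.exists_right p (hB.subset ha)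
    exact ⟨b, a, ha, hb⟩
  ne := hne
  absorbs := by
    intro j z hz hj
    have : ∀ i, ∃ a, p.rel R A a (z i) ∧ (i ≠ j → a ∈ B) := by
      intro i
      by_cases hi : i = j
      · subst hi
        obtain ⟨a, ha⟩ := hac.exists_left hinv p hj
        exact ⟨a, ha, fun h => (h rfl).elim⟩
      · obtain ⟨a, ha, h⟩ := hz i hi
        exact ⟨a, h, fun _ => ha⟩
    choose a h1 h2 using this
    refine ⟨g u a, hB.absorbs j a h2 (Pattern.rel_left (h1 j)),
      Pattern.absorbsRel_rel hR (fun w l y hy hl => hcl w y fun i => ?_) p j a z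
        (fun i _ => h1 i) (h1 j)⟩
    by_cases hi : i = l
    · rw [hi]; exact hl
    · exact hy i hi

/-- Two sets that are images of each other along closed patterns coincide. -/
theorem Reversible.image_eq (hrev : Reversible R A) {u : N} {B B' : Set (D u)}
    (p q : Pattern E u u) (hp : NearUnanimity.image R A p B = B')
    (hq : NearUnanimity.image R A q B' = B) : B = B' := by
  have sub : ∀ {B B' : Set (D u)} (p q : Pattern E u u), NearUnanimity.image R A p B = B' →
      NearUnanimity.image R A q B' = B → B' ⊆ B := by
    rintro B B' p q rfl hq b ⟨a, ha, hab⟩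
    have hclosed : ∀ x y, x ∈ B → (p.append q).rel R A x y → y ∈ B := by
      intro x y hx hxy
      rw [← hq, ← image_append]
      exact ⟨x, hx, hxy⟩
    have hba := hrev u p q a b hab
    -- Reversing each loop of the walk from `b` to `a` gives one from `a` to `b`, which stays in
    -- `B`.
    have hab' : ReflTransGen ((p.append q).rel R A) a b := by
      rw [← reflTransGen_swap] at hba
      refine reflTransGen_of_forall hba fun x y hxy => ?_
      have := hrev u (p.append q) (.nil u) y x hxy
      rwa [Pattern.append_nil] at this
    clear hab hba
    induction hab' with
    | refl => exact ha
    | tail _ h ih => exact hclosed _ _ ih h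
  exact (sub q p hq hp).antisymm (sub p q hp hq)

end Reduction

end NearUnanimity

/-! ### Shrinking domains to a solution -/

namespace NearUnanimity

open Relation

section Solution

variable {N : Type} {E : N → N → Type} {D : N → Type}
  {R : ∀ ⦃u v : N⦄, E u v → D u → D v → Prop} {A : ∀ u, Set (D u)}
  {m : ℕ} {g : ∀ u, (Fin m → D u) → D u}

/-- A proper absorbing set all of whose proper absorbing images lead back to it. -/
theorem exists_maximal_isProperAbsorbing [Finite N] [∀ u, Finite (D u)]
    {u₀ : N} {B₀ : Set (D u₀)} (h₀ : IsProperAbsorbing A g u₀ B₀) :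
    ∃ (u : N) (B : Set (D u)), IsProperAbsorbing A g u B ∧
      ∀ (v : N) (p : Pattern E u v), IsProperAbsorbing A g v (image R A p B) →
        ∃ q : Pattern E v u, image R A q (image R A p B) = B := by
  let S : Type := {s : Σ u, Set (D u) // IsProperAbsorbing A g s.1 s.2}
  let up : S → Set S := fun s => {t | ∃ p : Pattern E s.1.1 t.1.1, image R A p s.1.2 = t.1.2}
  have hS : Nonempty S := ⟨⟨⟨u₀, B₀⟩, h₀⟩⟩
  -- Reachability is a preorder on a finite set. An element with fewest elements above it is
  -- reachable from everything above it.
  obtain ⟨s, hs⟩ := Finite.exists_min (fun s => (up s).ncard)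
  refine ⟨s.1.1, s.1.2, s.2, fun v p hp => ?_⟩
  let t : S := ⟨⟨v, image R A p s.1.2⟩, hp⟩
  have hsub : up t ⊆ up s := by
    rintro r ⟨q, hq⟩
    exact ⟨p.append q, by rw [image_append]; exact hq⟩
  have heq : up t = up s := Set.eq_of_subset_of_ncard_le hsub (hs t)
  have hmem : s ∈ up s := by
    refine ⟨.nil _, Set.ext fun b => ?_⟩
    constructor
    · rintro ⟨a, ha, rfl, _⟩; exact ha
    · intro hb; exact ⟨b, hb, rfl, s.2.subset hb⟩
  rw [← heq] at hmem
  exact hmem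

/-- An instance with a nontrivial domain can be restricted to smaller domains without losing
arc consistency and reversibility. -/
theorem Reversible.exists_reduction [Finite N] [∀ u, Finite (D u)] (i₀ : Fin m)
    (hg : ∀ u, IsNU (g u))
    (hR : ∀ ⦃u v⦄ (e : E u v) (a : Fin m → D u) (b : Fin m → D v),
      (∀ i, R e (a i) (b i)) → R e (g u a) (g v b))
    (hinv : HasInverses R) (hcl : ∀ u (z : Fin m → D u), (∀ i, z i ∈ A u) → g u z ∈ A u)
    (hne : ∀ u, (A u).Nonempty) (hac : ArcConsistent R A) (hrev : Reversible R A)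
    {u₀ : N} (h₀ : ¬ (A u₀).Subsingleton) :
    ∃ A' : ∀ u, Set (D u), A' < A ∧
      (∀ u (z : Fin m → D u), (∀ i, z i ∈ A' u) → g u z ∈ A' u) ∧
      (∀ u, (A' u).Nonempty) ∧ ArcConsistent R A' ∧ Reversible R A' := by
  obtain ⟨a₀, ha₀⟩ := hne u₀
  -- Absorption by a singleton is exactly the near-unanimity identity.
  have hstart : IsProperAbsorbing A g u₀ {a₀} :=
    { subset := by simpa using ha₀
      nonempty := ⟨a₀, rfl⟩
      ne := fun e => h₀ (e ▸ Set.subsingleton_singleton)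
      absorbs := fun j z hz _ => (hg u₀).eq_of_forall_ne j hz }
  obtain ⟨u₁, B₁, hB₁, hmax⟩ := exists_maximal_isProperAbsorbing (R := R) hstart
  -- at each node at most one proper absorbing set is reachable from `B₁`
  have huniq : ∀ v (p q : Pattern E u₁ v), IsProperAbsorbing A g v (image R A p B₁) →
      IsProperAbsorbing A g v (image R A q B₁) → image R A p B₁ = image R A q B₁ := by
    intro v p q hp hq
    obtain ⟨p', hp'⟩ := hmax v p hp
    obtain ⟨q', hq'⟩ := hmax v q hq
    exact hrev.image_eq (p'.append q) (q'.append p) (by rw [image_append, hp'])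
      (by rw [image_append, hq'])
  -- By `huniq` this is the unique reachable proper absorbing set at `v` if there is one, and `A v`
  -- otherwise.
  let A' : ∀ u, Set (D u) := fun v => {a | a ∈ A v ∧ ∀ p : Pattern E u₁ v,
    IsProperAbsorbing A g v (image R A p B₁) → a ∈ image R A p B₁}
  have hsub : ∀ u, A' u ⊆ A u := fun u a ha => ha.1
  have hA' : ∀ v (p : Pattern E u₁ v), IsProperAbsorbing A g v (image R A p B₁) →
      A' v = image R A p B₁ := by
    intro v p hp
    refine Set.Subset.antisymm (fun a ha => ha.2 p hp) fun a ha => ⟨hp.subset ha, fun q hq => ?_⟩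
    rwa [huniq v q p hq hp]
  have hA'' : ∀ v, (¬ ∃ p : Pattern E u₁ v, IsProperAbsorbing A g v (image R A p B₁)) →
      A' v = A v := by
    intro v hv
    exact Set.Subset.antisymm (hsub v) fun a ha => ⟨ha, fun p hp => (hv ⟨p, hp⟩).elim⟩
  have habs : ∀ u (j : Fin m) (z : Fin m → D u), (∀ i, i ≠ j → z i ∈ A' u) → z j ∈ A u →
      g u z ∈ A' u := by
    intro u j z hz hj
    refine ⟨hcl u z fun i => ?_, fun p hp => hp.absorbs j z (fun i hi => (hz i hi).2 p hp) hj⟩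
    by_cases hi : i = j
    · rw [hi]; exact hj
    · exact hsub u (hz i hi)
  have hac' : ArcConsistent R A' := by
    intro u v e a ha
    by_cases hv : ∃ p : Pattern E u₁ v, IsProperAbsorbing A g v (image R A p B₁)
    · obtain ⟨p, hp⟩ := hv
      rw [hA' v p hp]
      obtain ⟨e', he'⟩ := hinv e
      -- The image pulled back along `e` is again reachable, so it is either all of `A u` or
      -- contains `A' u`.
      have hmem : a ∈ image R A (p.append (.cons e' (.nil u))) B₁ := by
        by_cases hfull : image R A (p.append (.cons e' (.nil u))) B₁ = A u
        · rw [hfull]; exact ha.1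
        · exact ha.2 _ (hB₁.image hR hinv hcl hac _ hfull)
      rw [image_append] at hmem
      obtain ⟨b, hb, -, c, hbc, rfl, -⟩ := hmem
      exact ⟨b, hb, (he' _ _).2 hbc⟩
    · rw [hA'' v hv]
      exact hac e a (hsub u ha)
  have hnil : image R A (.nil u₁) B₁ = B₁ := by
    ext b
    constructor
    · rintro ⟨a, ha, rfl, _⟩; exact ha
    · intro hb; exact ⟨b, hb, rfl, hB₁.subset hb⟩
  refine ⟨A', lt_of_le_of_ne hsub fun e => hB₁.ne ?_,
    fun u z hz => habs u i₀ z (fun i _ => hz i) (hsub u (hz i₀)), fun v => ?_, hac',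
    hrev.of_absorbing i₀ hg hR hinv hsub habs hac'⟩
  · rw [← e, hA' u₁ (.nil u₁) (hnil.symm ▸ hB₁), hnil]
  · by_cases hv : ∃ p : Pattern E u₁ v, IsProperAbsorbing A g v (image R A p B₁)
    · obtain ⟨p, hp⟩ := hv
      rw [hA' v p hp]
      exact hp.nonempty
    · rw [hA'' v hv]
      exact hne v

/-- Arc consistent reversible instances with near-unanimity operations are solvable. -/
theorem Reversible.exists_solution [Finite N] [∀ u, Finite (D u)] (i₀ : Fin m)
    (hg : ∀ u, IsNU (g u))
    (hR : ∀ ⦃u v⦄ (e : E u v) (a : Fin m → D u) (b : Fin m → D v),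
      (∀ i, R e (a i) (b i)) → R e (g u a) (g v b))
    (hinv : HasInverses R) (A : ∀ u, Set (D u))
    (hcl : ∀ u (z : Fin m → D u), (∀ i, z i ∈ A u) → g u z ∈ A u)
    (hne : ∀ u, (A u).Nonempty) (hac : ArcConsistent R A) (hrev : Reversible R A) :
    ∃ s : ∀ u, D u, (∀ u, s u ∈ A u) ∧ ∀ ⦃u v⦄ (e : E u v), R e (s u) (s v) := by
  induction A using WellFoundedLT.induction with
  | _ A ih =>
    by_cases hsing : ∀ u, (A u).Subsingleton
    · choose s hs using hne
      refine ⟨s, hs, fun u v e => ?_⟩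
      obtain ⟨b, hb, h⟩ := hac e (s u) (hs u)
      rwa [hsing v hb (hs v)] at h
    · push Not at hsing
      obtain ⟨u₀, h₀⟩ := hsing
      obtain ⟨A', hlt, h1, h2, h3, h4⟩ := hrev.exists_reduction i₀ hg hR hinv hcl hne hac
        (Set.not_subsingleton_iff.2 h₀)
      obtain ⟨s, hs, hs'⟩ := ih A' hlt h1 h2 h3 h4
      exact ⟨s, fun u => hlt.le u (hs u), hs'⟩

end Solution

end NearUnanimity

/-! ### Path-consistent systems via the incidence graph -/

namespace NearUnanimity

section Constraints

variable {V I K : Type} {r : I → ℕ} (s : ∀ c, Fin (r c) → V)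

/-- The edges of the incidence graph of a family of constraints with scopes `s`. -/
inductive Incidence : V ⊕ I → V ⊕ I → Type
  | down (c : I) (i : Fin (r c)) : Incidence (.inr c) (.inl (s c i))
  | up (c : I) (i : Fin (r c)) : Incidence (.inl (s c i)) (.inr c)

variable (K r) in
/-- Variables take values in `K`, constraints take tuples as values. -/
def Incidence.Dom : V ⊕ I → Type
  | .inl _ => K
  | .inr c => Fin (r c) → K

instance Incidence.finite_dom [Finite K] : ∀ u : V ⊕ I, Finite (Incidence.Dom K r u)
  | .inl _ => inferInstanceAs (Finite K)
  | .inr c => inferInstanceAs (Finite (Fin (r c) → K))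

variable {s} in
/-- A tuple of a constraint is incident with its entries. -/
def Incidence.Rel : ⦃u v : V ⊕ I⦄ → Incidence s u v →
    Incidence.Dom K r u → Incidence.Dom K r v → Prop
  | _, _, .down _ i, t, a => (show Fin (r _) → K from t) i = a
  | _, _, .up _ i, a, t => (show Fin (r _) → K from t) i = a

/-- The domains given by binary relations between the variables. -/
def Incidence.domain (ρ : ∀ c, Set (Fin (r c) → K)) (P : V → V → K → K → Prop) :
    ∀ u : V ⊕ I, Set (Incidence.Dom K r u)
  | .inl x => {a : K | P x x a a}
  | .inr c => {t : Fin (r c) → K | t ∈ ρ c ∧ ∀ i j, P (s c i) (s c j) (t i) (t j)}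

variable (r) in
/-- The places at which a path can leave or enter a node of the incidence graph. -/
def Incidence.Port : V ⊕ I → Type
  | .inl _ => Unit
  | .inr c => Fin (r c)

/-- The variable at a port. -/
def Incidence.portVar : ∀ u : V ⊕ I, Incidence.Port r u → V
  | .inl x, _ => x
  | .inr c, i => s c i

/-- The value of a variable at a port. -/
def Incidence.portVal : ∀ u : V ⊕ I, Incidence.Port r u → Incidence.Dom K r u → K
  | .inl _, _, a => a
  | .inr _, i, t => (show Fin (r _) → K from t) i

/-- The operation induced on the domains of the incidence graph. -/
def Incidence.lift {m : ℕ} (f : (Fin m → K) → K) :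
    ∀ u : V ⊕ I, (Fin m → Incidence.Dom K r u) → Incidence.Dom K r u
  | .inl _, z => f z
  | .inr _, z => fun j => f fun i => (show Fin (r _) → K from z i) j

open Incidence in
/-- A path-consistent system of binary relations that is compatible with all constraints has a
solution if a near-unanimity operation preserves everything. -/
theorem exists_solution_of_pathConsistent [Finite V] [Finite I] [Finite K]
    {m : ℕ} (i₀ : Fin m) {f : (Fin m → K) → K} (hf : IsNU f)
    (ρ : ∀ c, Set (Fin (r c) → K)) (P : V → V → K → K → Prop)
    (hρf : ∀ c (z : Fin m → Fin (r c) → K), (∀ i, z i ∈ ρ c) → (fun j => f fun i => z i j) ∈ ρ c)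
    (hPf : ∀ x y (a b : Fin m → K), (∀ i, P x y (a i) (b i)) → P x y (f a) (f b))
    (hne : ∀ x, ∃ a b, P x x a b) (hρne : ∀ c, (ρ c).Nonempty)
    (hdiag : ∀ x a b, P x x a b → a = b)
    (hcomp : ∀ x y z a c, P x z a c → ∃ b, P x y a b ∧ P y z b c)
    (hcon : ∀ c i j a b, P (s c i) (s c j) a b → ∃ t ∈ ρ c,
      (∀ i' j', P (s c i') (s c j') (t i') (t j')) ∧ t i = a ∧ t j = b) :
    ∃ F : V → K, (∀ x, P x x (F x) (F x)) ∧ ∀ c, (fun j => F (s c j)) ∈ ρ c := by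
  let A := Incidence.domain s ρ P
  have hdiag' : ∀ x a b, P x x a b → P x x a a := fun x a b h => by
    have e := hdiag x a b h
    subst e; exact h
  have hac : ArcConsistent (Rel (s := s) (K := K)) A := by
    intro u v e a ha
    cases e with
    | down c i => exact ⟨(show Fin (r c) → K from a) i, ha.2 i i, rfl⟩
    | up c i =>
      obtain ⟨t, h1, h2, h3, -⟩ := hcon c i i _ _ ha
      exact ⟨t, ⟨h1, h2⟩, h3⟩
  have hinv : HasInverses (Rel (s := s) (K := K)) := by
    intro u v e
    cases e with
    | down c i => exact ⟨.up c i, fun _ _ => Iff.rfl⟩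
    | up c i => exact ⟨.down c i, fun _ _ => Iff.rfl⟩
  -- a pattern with at least one edge contains the relation between its two end ports
  have hport : ∀ {u w v : V ⊕ I} (p : Pattern (Incidence s) w v) (e : Incidence s u w),
      ∃ (i : Port r u) (j : Port r v), ∀ a ∈ A u, ∀ b ∈ A v,
        P (portVar s u i) (portVar s v j) (portVal u i a) (portVal v j b) →
        (Pattern.cons e p).rel Rel A a b := by
    intro u w v p
    induction p generalizing u with
    | nil w =>
      intro e
      cases e with
      | down c i =>
        exact ⟨i, (), fun a ha b hb h => ⟨ha, b, hdiag _ _ _ h, rfl, hb⟩⟩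
      | up c i =>
        exact ⟨(), i, fun a ha b hb h => ⟨ha, b, (hdiag _ _ _ h).symm, rfl, hb⟩⟩
    | cons e' p ih =>
      intro e
      obtain ⟨i', j, h⟩ := ih e'
      cases e with
      | down c i =>
        exact ⟨i, j, fun a ha b hb hab =>
          ⟨ha, (show Fin (r c) → K from a) i, rfl, h _ (ha.2 i i) b hb hab⟩⟩
      | up c i =>
        -- Composition supplies a value at the port where the path leaves the constraint, and `hcon`
        -- extends both values to a tuple.
        refine ⟨(), j, fun a ha b hb hab => ?_⟩
        obtain ⟨d, h1, h2⟩ := hcomp _ (s c i') _ _ _ hab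
        obtain ⟨t, q1, q2, q3, q4⟩ := hcon c i i' _ _ h1
        refine ⟨ha, t, q3, h t ⟨q1, q2⟩ b hb ?_⟩
        have : portVal (K := K) (.inr c) i' t = d := q4
        rw [this]
        exact h2
  have hrev : Reversible (Rel (s := s) (K := K)) A := by
    refine reversible_of_edge hac ?_
    intro u v e p a ha b hb hab
    cases p with
    | nil => cases e
    | cons e' p =>
      obtain ⟨i', j, h⟩ := hport p e'
      refine h b hb a ha ?_
      -- The entries of the tuple at the constraint end are pairwise related by `P`, as the
      -- returning pattern requires.
      cases e with
      | down c i =>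
        have hab : (show Fin (r c) → K from a) i = b := hab
        subst hab
        exact ha.2 i j
      | up c i =>
        have hab : (show Fin (r c) → K from b) i = a := hab
        subst hab
        exact hb.2 i' i
  have hlift : ∀ u : V ⊕ I, IsNU (lift (r := r) f u) := by
    rintro (x | c) a b i
    · exact hf a b i
    · funext j
      refine hf.eq_of_forall_ne i fun l hl => ?_
      simp [hl]
  have hpres : ∀ ⦃u v⦄ (e : Incidence s u v) (a : Fin m → Dom K r u) (b : Fin m → Dom K r v),
      (∀ i, Rel e (a i) (b i)) → Rel e (lift f u a) (lift f v b) := by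
    intro u v e a b h
    cases e with
    | down c i => exact congrArg f (funext h)
    | up c i => exact congrArg f (funext h)
  have hclosed : ∀ u (z : Fin m → Dom K r u), (∀ i, z i ∈ A u) → lift f u z ∈ A u := by
    rintro (x | c) z hz
    · exact hPf x x _ _ hz
    · exact ⟨hρf c _ fun i => (hz i).1, fun i j => hPf _ _ _ _ fun l => (hz l).2 i j⟩
  have hnonempty : ∀ u, (A u).Nonempty := by
    rintro (x | c)
    · obtain ⟨a, b, h⟩ := hne x
      exact ⟨a, hdiag' _ _ _ h⟩
    · by_cases hc : Nonempty (Fin (r c))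
      · obtain ⟨i⟩ := hc
        obtain ⟨a, b, h⟩ := hne (s c i)
        obtain ⟨t, h1, h2, -⟩ := hcon c i i a b h
        exact ⟨t, h1, h2⟩
      -- Constraints of arity 0 have no variable to start from.
      · obtain ⟨t, ht⟩ := hρne c
        exact ⟨t, ht, fun i => (hc ⟨i⟩).elim⟩
  obtain ⟨S, hS, hS'⟩ := hrev.exists_solution i₀ hlift hpres hinv A hclosed hnonempty hac
  refine ⟨fun x => S (.inl x), fun x => hS (.inl x), fun c => ?_⟩
  have : (fun j => S (.inl (s c j))) = S (.inr c) := funext fun j => (hS' (.down c j)).symm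
  rw [this]
  exact (hS (.inr c)).1

end Constraints

end NearUnanimity

/-! ### Derived binary relations and the indicator instance -/

namespace NearUnanimity

/-- The inner nodes of the formulas that derive binary relations from `G`. -/
inductive Rule {k : ℕ} (G : Finset (Pred k)) : Type
  | eq : Rule G
  | inter : Rule G
  | comp : Rule G
  | app (ρ : {ρ // ρ ∈ G}) (i j : Fin ρ.1.1) : Rule G

namespace Rule

variable {k : ℕ} {G : Finset (Pred k)}

/-- The premises of a rule. -/
def Arg : Rule G → Type
  | eq => Empty
  | inter => Bool
  | comp => Bool
  | app ρ _ _ => Fin ρ.1.1 × Fin ρ.1.1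

instance fintypeArg : ∀ o : Rule G, Fintype o.Arg
  | eq => inferInstanceAs (Fintype Empty)
  | inter => inferInstanceAs (Fintype Bool)
  | comp => inferInstanceAs (Fintype Bool)
  | app ρ _ _ => inferInstanceAs (Fintype (Fin ρ.1.1 × Fin ρ.1.1))

/-- The relation between the premises and the conclusion of a rule: equality, intersection,
composition, and the projection of a predicate of `G` with restricted binary projections. -/
def rel : ∀ o : Rule G, (o.Arg → Fin k × Fin k) → Fin k × Fin k → Prop
  | eq, _, y => y.1 = y.2
  | inter, t, y => ∀ b : Bool, t b = y
  | comp, t, y => (t false).2 = (t true).1 ∧ y = ((t false).1, (t true).2)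
  | app ρ i j, t, y => ∃ w ∈ ρ.1.2, (∀ p : Fin ρ.1.1 × Fin ρ.1.1, t p = (w p.1, w p.2)) ∧
      y = (w i, w j)

theorem card_arg_le (o : Rule G) : Fintype.card o.Arg ≤ max 2 (ar G ^ 2) := by
  cases o with
  | eq => exact (Fintype.card_eq_zero (α := Empty)).le.trans (Nat.zero_le _)
  | inter => exact Fintype.card_bool.le.trans (le_max_left _ _)
  | comp => exact Fintype.card_bool.le.trans (le_max_left _ _)
  | app ρ i j =>
    have h : ρ.1.1 ≤ ar G := Finset.le_sup (f := fun ρ : Pred k => ρ.1) ρ.2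
    have e : Fintype.card (Rule.app ρ i j).Arg = ρ.1.1 * ρ.1.1 :=
      (Fintype.card_prod (Fin ρ.1.1) (Fin ρ.1.1)).trans (by simp)
    rw [e, ← sq]
    exact (Nat.pow_le_pow_left h 2).trans (le_max_right _ _)

end Rule

/-- The operation induced on pairs. -/
def pairOp {k m : ℕ} (f : Op k m) (z : Fin m → Fin k × Fin k) : Fin k × Fin k :=
  (f fun i => (z i).1, f fun i => (z i).2)

theorem isNU_pairOp {k m : ℕ} {f : Op k m} (hf : IsNU f) : IsNU (pairOp f) := by
  intro x y i
  exact Prod.ext (hf.eq_of_forall_ne i fun j hj => by simp [hj])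
    (hf.eq_of_forall_ne i fun j hj => by simp [hj])

theorem Rule.rel_pairOp {k m : ℕ} {G : Finset (Pred k)} {f : Op k m}
    (hf : f ∈ Pol (G : Set (Pred k)) m) (o : Rule G) (t : Fin m → o.Arg → Fin k × Fin k)
    (y : Fin m → Fin k × Fin k) (h : ∀ i, o.rel (t i) (y i)) :
    o.rel (fun j => pairOp f fun i => t i j) (pairOp f y) := by
  cases o with
  | eq => exact congrArg f (funext h)
  | inter => exact fun b => congrArg (pairOp f) (funext fun i => h i b)
  | comp =>
    have h1 : ∀ i, (t i false).2 = (t i true).1 := fun i => (h i).1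
    have h2 : ∀ i, y i = ((t i false).1, (t i true).2) := fun i => (h i).2
    refine ⟨congrArg f (funext h1), ?_⟩
    rw [funext h2]
    rfl
  | app ρ i j =>
    choose w h1 h2 h3 using h
    refine ⟨_, hf ρ.1 ρ.2 w h1, fun p => ?_, ?_⟩
    · exact congrArg (pairOp f) (funext fun l => h2 l p)
    · rw [funext h3]
      rfl

variable {k : ℕ} {G : Finset (Pred k)}

/-- Among the binary relations derived for a given type there is a least one. -/
theorem exists_least_typed {n : ℕ} (σ : Fin n → Fin k × Fin k) :
    ∃ T : Term (Fin k × Fin k) (Rule G) Rule.Arg, T.Typed Rule.rel σ ∧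
      ∀ T' : Term (Fin k × Fin k) (Rule G) Rule.Arg, T'.Typed Rule.rel σ →
        T.val Rule.rel ⊆ T'.val Rule.rel := by
  let 𝒮 : Set (Set (Fin k × Fin k)) :=
    {B | ∃ T : Term (Fin k × Fin k) (Rule G) Rule.Arg, T.Typed Rule.rel σ ∧ T.val Rule.rel = B}
  obtain ⟨B, ⟨T, hT, rfl⟩, hmin⟩ :=
    (Set.toFinite 𝒮).exists_minimal ⟨_, Term.top, trivial, rfl⟩
  refine ⟨T, hT, fun T' hT' => ?_⟩
  -- Typed formulas are closed under intersection, so a minimal relation is least.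
  let U : Term (Fin k × Fin k) (Rule G) Rule.Arg :=
    .node .inter fun b : Bool => if b then T' else T
  have hU : U.Typed Rule.rel σ := by
    refine ⟨fun _ => σ, fun _ _ => rfl, fun b => ?_⟩
    cases b
    · exact hT
    · exact hT'
  have hval : ∀ y ∈ U.val Rule.rel, y ∈ T.val Rule.rel ∧ y ∈ T'.val Rule.rel := by
    rintro y ⟨t, h1, h2⟩
    have e0 : t false = y := h1 false
    have e1 : t true = y := h1 true
    exact ⟨e0 ▸ h2 false, e1 ▸ h2 true⟩
  exact fun y hy => (hval y (hmin ⟨U, hU, rfl⟩ (fun z hz => (hval z hz).1) hy)).2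

/-- If `G` admits some near-unanimity function, it admits one of every sufficiently large
arity, with an explicit bound. -/
theorem exists_nuf_of_lt {m n : ℕ} (i₀ : Fin m) {f : Op k m} (hf : f ∈ NUF k m)
    (hfG : f ∈ Pol (G : Set (Pred k)) m) (hn : max 2 (ar G ^ 2) ^ 3 ^ (k ^ 2) < n) :
    (NUF k n ∩ Pol (G : Set (Pred k)) n).Nonempty := by
  have hNU : IsNU f := fun x y i => hf y x i
  choose T hT hleast using fun σ : Fin n → Fin k × Fin k => exists_least_typed (G := G) σ
  let ty : (Fin n → Fin k) → (Fin n → Fin k) → Fin n → Fin k × Fin k := fun x y i => (x i, y i)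
  let P : (Fin n → Fin k) → (Fin n → Fin k) → Fin k → Fin k → Prop :=
    fun x y a b => (a, b) ∈ (T (ty x y)).val Rule.rel
  have hnonempty : ∀ σ, ((T σ).val Rule.rel).Nonempty := fun σ =>
    Term.Typed.val_nonempty (isNU_pairOp hNU) i₀ (Rule.rel_pairOp hfG)
      (β := max 2 (ar G ^ 2)) (le_max_of_le_left one_le_two) Rule.card_arg_le
      (by simpa [sq] using hn) σ (T σ) (hT σ)
  have hn0 : 0 < n := lt_of_le_of_lt (Nat.zero_le _) hn
  let I : Type := Σ ρ : {ρ // ρ ∈ G},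
    {s : Fin ρ.1.1 → Fin n → Fin k // ∀ i, (fun j => s j i) ∈ ρ.1.2}
  suffices hsol : ∃ F : (Fin n → Fin k) → Fin k, (∀ x, P x x (F x) (F x)) ∧
      ∀ c : I, (fun j => F (c.2.1 j)) ∈ c.1.1.2 by
    obtain ⟨F, hF1, hF2⟩ := hsol
    refine ⟨F, fun a b i => ?_, fun ρ hρ α hα => ?_⟩
    -- A single leaf is a typed formula for a near-constant tuple, so it forces the value `b`.
    · have hle := hleast (ty (Function.update (fun _ => b) i a) (Function.update (fun _ => b) i a))
        (.leaf (b, b)) ⟨i, fun j hj => by simp [ty, hj]⟩ (hF1 _)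
      exact congrArg Prod.fst hle
    · exact hF2 ⟨⟨ρ, hρ⟩, fun j i => α i j, hα⟩
  refine exists_solution_of_pathConsistent (V := Fin n → Fin k) (I := I)
    (r := fun c => c.1.1.1) (fun c => c.2.1) i₀ hNU (fun c => c.1.1.2) P ?_ ?_ ?_ ?_ ?_ ?_ ?_
  · exact fun c z hz => hfG c.1.1 c.1.2 z hz
  · exact fun x y a b h => Term.val_closed (isNU_pairOp hNU) i₀ (Rule.rel_pairOp hfG) (T (ty x y))
      (fun i => (a i, b i)) h
  · intro x
    obtain ⟨⟨a, b⟩, h⟩ := hnonempty (ty x x)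
    exact ⟨a, b, h⟩
  · exact fun c => ⟨_, c.2.2 ⟨0, hn0⟩⟩
  -- From here on, each condition holds because the least relation lies inside the one derived by
  -- the corresponding rule.
  · intro x a b h
    obtain ⟨t, h1, -⟩ := hleast (ty x x) (.node .eq Empty.elim)
      ⟨Empty.elim, fun i => rfl, fun e => e.elim⟩ h
    exact h1
  · intro x y z a c h
    obtain ⟨t, ⟨h1, h2⟩, h3⟩ := hleast (ty x z)
      (.node .comp fun b : Bool => if b then T (ty y z) else T (ty x y))
      ⟨fun b : Bool => if b then ty y z else ty x y, fun i => ⟨rfl, rfl⟩, fun b => by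
        cases b
        · exact hT _
        · exact hT _⟩ h
    have hf := h3 false
    have ht := h3 true
    have ea : a = (t false).1 := congrArg Prod.fst h2
    have ec : c = (t true).2 := congrArg Prod.snd h2
    refine ⟨(t false).2, ?_, ?_⟩
    · rw [ea]; exact hf
    · rw [ec, h1]; exact ht
  · intro c i j a b h
    obtain ⟨t, ⟨w, h1, h2, h3⟩, h4⟩ := hleast (ty (c.2.1 i) (c.2.1 j))
      (.node (.app c.1 i j) fun p => T (ty (c.2.1 p.1) (c.2.1 p.2)))
      ⟨fun p => ty (c.2.1 p.1) (c.2.1 p.2), fun l => ⟨_, c.2.2 l, fun _ => rfl, rfl⟩,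
        fun p => hT _⟩ h
    refine ⟨w, h1, fun i' j' => ?_, (congrArg Prod.fst h3).symm, (congrArg Prod.snd h3).symm⟩
    have := h4 (i', j')
    rw [h2 (i', j')] at this
    exact this

/-! ### Numerical bound and conclusion -/

theorem two_mul_three_pow_lt {q : ℕ} (hq : 3 ≤ q) : 2 * 3 ^ q < 4 ^ q := by
  induction q, hq using Nat.le_induction with
  | base => norm_num
  | succ q _ ih => rw [pow_succ, pow_succ]; omega

/-- The base on the left is at most (ka)², and 2·3^(k²) < 4^(k²) = 2^(2k²). -/
theorem bound_lt {k a : ℕ} (hk : 2 ≤ k) (ha : 1 ≤ a) :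
    max 2 (a ^ 2) ^ 3 ^ (k ^ 2) < (k * a) ^ (2 ^ (2 * k ^ 2) + 2) := by
  have h2 : 2 ≤ k * a := by nlinarith
  have hbase : max 2 (a ^ 2) ≤ (k * a) ^ 2 := max_le (by nlinarith)
    (Nat.pow_le_pow_left (by nlinarith) 2)
  calc max 2 (a ^ 2) ^ 3 ^ (k ^ 2) ≤ ((k * a) ^ 2) ^ 3 ^ (k ^ 2) := Nat.pow_le_pow_left hbase _
    _ = (k * a) ^ (2 * 3 ^ (k ^ 2)) := (pow_mul _ _ _).symm
    _ < _ := by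
      refine Nat.pow_lt_pow_right h2 ?_
      rw [pow_mul]
      have := two_mul_three_pow_lt (q := k ^ 2) (by nlinarith)
      norm_num
      omega

/-- Positive arity matters: a nullary function does not preserve an empty predicate. -/
theorem nonempty_of_subsingleton (G : Finset (Pred 1)) {n : ℕ} (hn : 0 < n) :
    (NUF 1 n ∩ Pol (G : Set (Pred 1)) n).Nonempty := by
  refine ⟨fun _ => 0, fun _ _ _ => Subsingleton.elim _ _, fun ρ _ α hα => ?_⟩
  convert hα ⟨0, hn⟩

end NearUnanimity

theorem theorem1 (k : ℕ) (hk : 1 ≤ k) (G : Finset (NearUnanimity.Pred k))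
    (hG : 1 ≤ NearUnanimity.ar G) :
    (∃ m : ℕ, 3 ≤ m ∧
        (NearUnanimity.NUF k m ∩ NearUnanimity.Pol (G : Set (NearUnanimity.Pred k)) m).Nonempty) ↔
      (NearUnanimity.NUF k ((k * NearUnanimity.ar G) ^ (2 ^ (2 * k ^ 2) + 2)) ∩
        NearUnanimity.Pol (G : Set (NearUnanimity.Pred k))
          ((k * NearUnanimity.ar G) ^ (2 ^ (2 * k ^ 2) + 2))).Nonempty := by
  rcases hk.eq_or_lt with rfl | hk
  · refine iff_of_true ⟨3, le_rfl, NearUnanimity.nonempty_of_subsingleton G (by norm_num)⟩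
      (NearUnanimity.nonempty_of_subsingleton G ?_)
    exact Nat.pow_pos (by omega)
  · have hlt := NearUnanimity.bound_lt hk hG
    constructor
    · rintro ⟨m, hm, f, hf, hfG⟩
      exact NearUnanimity.exists_nuf_of_lt ⟨0, by omega⟩ hf hfG hlt
    · intro h
      refine ⟨_, ?_, h⟩
      -- Together with `hlt` this gives arity at least 3.
      have h1 : 2 ≤ max 2 (NearUnanimity.ar G ^ 2) ^ 3 ^ (k ^ 2) :=
        (le_max_left _ _).trans (Nat.le_self_pow (by positivity) _)
      omega
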